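/- Let $L^2(\partial\mathbb D)$ be taken with respect to normalized arc length on the unit circle, and let $H^2\subset L^2(\partial\mathbb D)$ be the Hardy space of the unit disk $\mathbb D$ (the functions whose Fourier coefficients of negative index vanish). For a finite Blaschke product $\alpha$, that is, $\alpha(z)=c\prod_{j=1}^m\frac{z-a_j}{1-\overline{a_j}z}$ with $|c|=1$ and $a_1,\dots,a_m\in\mathbb D$ (its degree is $m$), let $K_\alpha=H^2\ominus\alpha H^2$ be the model space, and for $w\in\overline{\mathbb D}$ put $$k_w^\alpha(z)=\frac{1-\overline{\alpha(w)}\alpha(z)}{1-\overline w z},\qquad \widetilde k_w^\alpha(z)=(C_\alpha k_w^\alpha)(z)=\alpha(z)\,\overline z\,\overline{k_w^\alpha(z)}=\frac{\alpha(z)-\alpha(w)}{z-w}\qquad(|z|=1,\ z\neq w).$$ For finite Blaschke products $\alpha,\beta$ let $P_\beta$ be the orthogonal projection of $L^2(\partial\mathbb D)$ onto $K_\beta$, and let $\mathscr T(\alpha,\beta)$ be the set of all bounded operators $A\colon K_\alpha\to K_\beta$ for which there is $\varphi\in L^2(\partial\mathbb D)$ with $Af=P_\beta(\varphi f)$ for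 all bounded $f\in K_\alpha$. For $f\in K_\alpha$ and $g\in K_\beta$ let $g\otimes f\colon K_\alpha\to K_\beta$ be the operator $(g\otimes f)h=\langle h,f\rangle g$. Let $\alpha$ and $\beta$ be finite Blaschke products of degree $m>1$ and $n>1$, respectively. Let $f\in K_\alpha$ and $g\in K_\beta$ be nonzero functions such that $g\otimes f\in\mathscr T(\alpha,\beta)$, and let $w\in\overline{\mathbb D}$. Then (a) $g$ is a scalar multiple of $k_w^\beta$ if and only if $f$ is a scalar multiple of $\widetilde k_w^\alpha$; (b) $g$ is a scalar multiple of $\widetilde k_w^\beta$ if and only if $f$ is a scalar multiple of $k_w^\alpha$. -/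

import Mathlib

open scoped ComplexConjugate ENNReal

noncomputable section

namespace ModelSpace

open MeasureTheory

/-- Normalised arc length `dθ / 2π` on the unit circle, parametrised by `ℝ / ℤ`. -/
abbrev arc : Measure UnitAddCircle := AddCircle.haarAddCircle

/-- The point `e^{2πit}` of the unit circle with parameter `t`. -/
def pt (t : UnitAddCircle) : ℂ := (AddCircle.toCircle t : ℂ)

/-- `L²(∂𝔻)`. -/
abbrev L2 : Type := Lp ℂ 2 arc

/-- The Hardy space `H²`, as the subspace of `L²(∂𝔻)` of all functions (boundary values) whose
Fourier coefficients of negative index vanish. -/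
def hardy : Submodule ℂ L2 :=
  (Submodule.span ℂ {e : L2 | ∃ n : ℤ, n < 0 ∧ e = fourierLp 2 n})ᗮ

theorem mem_hardy_iff (u : L2) : u ∈ hardy ↔ ∀ n : ℤ, n < 0 → fourierCoeff u n = 0 := by
  have key : ∀ n : ℤ, fourierCoeff u n = inner ℂ (fourierLp 2 n : L2) u := by
    intro n
    rw [← fourierBasis_repr, HilbertBasis.repr_apply_apply, coe_fourierBasis]
  rw [hardy, Submodule.mem_orthogonal]
  constructor
  · intro h n hn
    rw [key]
    exact h _ (Submodule.subset_span ⟨n, hn, rfl⟩)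
  · intro h e he
    induction he using Submodule.span_induction with
    | mem x hx => obtain ⟨n, hn, rfl⟩ := hx; rw [← key]; exact h n hn
    | zero => exact inner_zero_left _
    | add x y _ _ hx hy => rw [inner_add_left, hx, hy, add_zero]
    | smul c x _ hx => rw [inner_smul_left, hx, mul_zero]

/-- `α H²`, as a subspace of `L²(∂𝔻)`. -/
def mulHardy (α : ℂ → ℂ) : Submodule ℂ L2 where
  carrier := {h | ∃ u ∈ hardy, ∀ᵐ t ∂arc, h t = α (pt t) * u t}
  zero_mem' := by
    refine ⟨0, hardy.zero_mem, ?_⟩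
    filter_upwards [Lp.coeFn_zero ℂ 2 arc] with t ht
    rw [ht]; simp
  add_mem' := by
    rintro h₁ h₂ ⟨u₁, hu₁, e₁⟩ ⟨u₂, hu₂, e₂⟩
    refine ⟨u₁ + u₂, hardy.add_mem hu₁ hu₂, ?_⟩
    filter_upwards [e₁, e₂, Lp.coeFn_add h₁ h₂, Lp.coeFn_add u₁ u₂] with t a b c d
    rw [c, d, Pi.add_apply, Pi.add_apply, a, b, mul_add]
  smul_mem' := by
    rintro c h ⟨u, hu, e⟩
    refine ⟨c • u, hardy.smul_mem c hu, ?_⟩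
    filter_upwards [e, Lp.coeFn_smul c h, Lp.coeFn_smul c u] with t a b d
    rw [b, d, Pi.smul_apply, Pi.smul_apply, a, smul_eq_mul, smul_eq_mul, mul_left_comm]

/-- The model space `K_α = H² ⊖ αH²`. -/
def K (α : ℂ → ℂ) : Submodule ℂ L2 := hardy ⊓ (mulHardy α)ᗮ

instance (α : ℂ → ℂ) : CompleteSpace (K α) := by
  have h : IsClosed ((K α : Submodule ℂ L2) : Set L2) := by
    rw [K, Submodule.coe_inf]
    exact (Submodule.isClosed_orthogonal _).inter (Submodule.isClosed_orthogonal _)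
  exact h.completeSpace_coe

/-- `α` is a finite Blaschke product of degree `m` (as a function on the closed unit disk; its
values elsewhere are irrelevant). -/
def IsFiniteBlaschke (m : ℕ) (α : ℂ → ℂ) : Prop :=
  ∃ (c : ℂ) (a : Fin m → ℂ), ‖c‖ = 1 ∧ (∀ j, ‖a j‖ < 1) ∧
    ∀ z : ℂ, ‖z‖ ≤ 1 → α z = c * ∏ j, (z - a j) / (1 - conj (a j) * z)

/-- The reproducing kernel `k_w^α`. For `‖w‖ = 1` the denominator vanishes only at `z = w`. -/
def kernel (α : ℂ → ℂ) (w z : ℂ) : ℂ := (1 - conj (α w) * α z) / (1 - conj w * z)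

/-- The conjugation `C_α`, on functions on the unit circle. -/
def conjugation (α : ℂ → ℂ) (u : ℂ → ℂ) (z : ℂ) : ℂ := α z * conj z * conj (u z)

/-- The conjugate kernel `C_α k_w^α`, on the unit circle. -/
def conjKernel (α : ℂ → ℂ) (w : ℂ) : ℂ → ℂ := conjugation α (kernel α w)

/-- The usual closed form of the conjugate kernel on the unit circle. -/
theorem conjKernel_eq (α : ℂ → ℂ) (w z : ℂ) (hz : ‖z‖ = 1) (hα : ‖α z‖ = 1) :
    conjKernel α w z = (α z - α w) / (z - w) := by
  have h1 : z * conj z = 1 := by rw [Complex.mul_conj']; simp [hz]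
  have h2 : α z * conj (α z) = 1 := by rw [Complex.mul_conj']; simp [hα]
  have hd : z - w = z * (1 - w * conj z) := by linear_combination w * h1
  have hn : α z - α w = α z * (1 - α w * conj (α z)) := by linear_combination α w * h2
  have hi : conj z = z⁻¹ := eq_inv_of_mul_eq_one_right h1
  rw [hd, hn]
  simp only [conjKernel, conjugation, kernel, map_div₀, map_sub, map_mul, map_one,
    Complex.conj_conj]
  rw [mul_div_mul_comm, hi, div_eq_mul_inv (α z) z]

/-- The element `u` of `L²(∂𝔻)` is a scalar multiple of the function `k` on the unit circle. -/
def IsScalarMultiple (u : L2) (k : ℂ → ℂ) : Prop :=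
  ∃ c : ℂ, ∀ᵐ t ∂arc, u t = c * k (pt t)

/-- The product `φ f ∈ L²(∂𝔻)` of `φ ∈ L²(∂𝔻)` and a bounded `f`. -/
def mulBdd (φ f : L2) (hf : MemLp f ∞ arc) : L2 :=
  MemLp.toLp (fun t => φ t * f t) (hf.mul' (Lp.memLp φ))

/-- The bounded asymmetric truncated Toeplitz operators from `K_α` to `K_β`: bounded operators
`A` such that for some symbol `φ ∈ L²(∂𝔻)`, `A f = P_β (φ f)` for all bounded `f ∈ K_α`. -/
def attOperators (α β : ℂ → ℂ) : Set (K α →L[ℂ] K β) :=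
  {A | ∃ φ : L2, ∀ (f : K α) (hf : MemLp (f : L2) ∞ arc),
    A f = (K β).orthogonalProjectionOnto (mulBdd φ f hf)}

end ModelSpace

end

noncomputable section

namespace ModelSpace

open MeasureTheory Polynomial

/-! ### The unit circle -/

/-! With `den` the product of the factors `1 - conj a_j z`, the model space is the set of `p / den`
with `deg p < m` (`ratio_mem_K`, `exists_eq_ratio`), so its elements are determined by their moments
against `e_k = z^k / den`, `k < m`.

Kernels are recognised by geometric moments. Pairing with `k_w` evaluates at `w`, so `u` is a
multiple of `k_w` iff its moments satisfy `u_{k+1} = w u_k`; it is a multiple of the conjugate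
kernel iff `u_k = conj w * u_{k+1}`.

The matrix entry of an operator with symbol `φ` between `e_k` and `e'_l` integrates `φ z^k
conj(z)^l` against a fixed factor, and hence depends only on `k - l` because `|z| = 1`. For `g ⊗ f`
this entry is `x_k y_l`, with `x_k` a moment of `f` and `y_l` a conjugated moment of `g`. So
`x_{k+1} y_{l+1} = x_k y_l`, and `geometric_iff_of_mul_succ` turns a geometric law for one sequence
into the reversed law for the other. -/

theorem norm_pt (t : UnitAddCircle) : ‖pt t‖ = 1 := Circle.norm_coe _

theorem pt_ne_zero (t : UnitAddCircle) : pt t ≠ 0 := Circle.coe_ne_zero _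

theorem continuous_pt : Continuous pt := continuous_subtype_val.comp AddCircle.continuous_toCircle

theorem injective_pt : Function.Injective pt :=
  Subtype.val_injective.comp (AddCircle.injective_toCircle one_ne_zero)

theorem mul_conj_of_norm_eq_one {z : ℂ} (hz : ‖z‖ = 1) : z * conj z = 1 := by
  rw [Complex.mul_conj']; simp [hz]

theorem fourier_eq_pt_zpow (n : ℤ) (t : UnitAddCircle) : fourier n t = pt t ^ n := by
  rw [fourier_apply, AddCircle.toCircle_zsmul, Circle.coe_zpow, pt]

instance : Infinite UnitAddCircle :=
  (AddCircle.equivIco (1 : ℝ) 0).infinite_iff.mpr (Set.Ico_infinite (by norm_num)).to_subtype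

/-- This lets boundary points `w` be treated like interior ones: the kernel formulas can fail only
at `z = w`. -/
theorem ae_pt_ne (w : ℂ) : ∀ᵐ t ∂arc, pt t ≠ w := by
  have h : Set.Subsingleton {t | pt t = w} := fun s hs t ht => injective_pt (hs.trans ht.symm)
  rw [ae_iff]
  simpa using h.measure_zero arc

theorem memLp_of_continuous {F : UnitAddCircle → ℂ} (hF : Continuous F) (p : ℝ≥0∞) :
    MemLp F p arc :=
  hF.memLp_of_hasCompactSupport (HasCompactSupport.of_compactSpace F)

theorem integrable_continuous_mul {F G : UnitAddCircle → ℂ} (hG : Continuous G)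
    (hF : Integrable F arc) : Integrable (fun t => G t * F t) arc := by
  obtain ⟨C, hC⟩ := (isCompact_range hG).isBounded.exists_norm_le
  exact hF.bdd_mul hG.aestronglyMeasurable
    (Filter.Eventually.of_forall fun t => hC _ ⟨t, rfl⟩)

theorem integrable_L2 (u : L2) : Integrable u arc :=
  (Lp.memLp u).integrable (by norm_num)

/-! ### Integrable functions with vanishing negative Fourier coefficients -/

/-- Integrable functions on the circle whose Fourier coefficients of negative index vanish. -/
def IsHardy (F : UnitAddCircle → ℂ) : Prop :=
  Integrable F arc ∧ ∀ n : ℕ, ∫ t, pt t ^ (n + 1) * F t ∂arc = 0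

theorem fourierCoeff_eq_integral_pt (F : UnitAddCircle → ℂ) (n : ℤ) :
    fourierCoeff F n = ∫ t, pt t ^ (-n) * F t ∂arc := by
  simp only [fourierCoeff, fourier_eq_pt_zpow, smul_eq_mul]

theorem mem_hardy_iff_isHardy (u : L2) : u ∈ hardy ↔ IsHardy u := by
  rw [mem_hardy_iff]
  constructor
  · refine fun h => ⟨integrable_L2 u, fun n => ?_⟩
    have := h (-((n : ℤ) + 1)) (by omega)
    rw [fourierCoeff_eq_integral_pt, neg_neg] at this
    exact_mod_cast this
  · rintro ⟨-, h⟩ n hn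
    obtain ⟨k, rfl⟩ : ∃ k : ℕ, n = -((k : ℤ) + 1) := ⟨(-n - 1).toNat, by omega⟩
    rw [fourierCoeff_eq_integral_pt, neg_neg]
    exact_mod_cast h k

theorem IsHardy.congr {F G : UnitAddCircle → ℂ} (hF : IsHardy F) (h : F =ᵐ[arc] G) :
    IsHardy G := by
  refine ⟨hF.1.congr h, fun n => ?_⟩
  rw [← hF.2 n]
  refine integral_congr_ae ?_
  filter_upwards [h] with t ht
  rw [ht]

theorem IsHardy.pow_mul {F : UnitAddCircle → ℂ} (hF : IsHardy F) (k : ℕ) :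
    IsHardy fun t => pt t ^ k * F t := by
  refine ⟨integrable_continuous_mul (continuous_pt.pow k) hF.1, fun n => ?_⟩
  rw [← hF.2 (n + k)]
  congr 1; ext t; ring

theorem IsHardy.const_mul {F : UnitAddCircle → ℂ} (hF : IsHardy F) (c : ℂ) :
    IsHardy fun t => c * F t := by
  refine ⟨hF.1.const_mul c, fun n => ?_⟩
  simp_rw [mul_left_comm _ c]
  rw [integral_const_mul, hF.2, mul_zero]

theorem IsHardy.add {F G : UnitAddCircle → ℂ} (hF : IsHardy F) (hG : IsHardy G) :
    IsHardy fun t => F t + G t := by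
  refine ⟨hF.1.add hG.1, fun n => ?_⟩
  simp_rw [mul_add]
  rw [integral_add, hF.2, hG.2, add_zero]
  · exact integrable_continuous_mul (continuous_pt.pow _) hF.1
  · exact integrable_continuous_mul (continuous_pt.pow _) hG.1

theorem isHardy_one : IsHardy fun _ => 1 := by
  refine ⟨integrable_const 1, fun n => ?_⟩
  have h := congrFun (fourierCoeff_fourier (T := 1) 0) (-((n : ℤ) + 1))
  rw [fourierCoeff_eq_integral_pt, neg_neg, Pi.single_eq_of_ne (by omega)] at h
  simp only [fourier_zero] at h
  exact_mod_cast h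

theorem IsHardy.eval_mul {F : UnitAddCircle → ℂ} (hF : IsHardy F) (p : ℂ[X]) :
    IsHardy fun t => p.eval (pt t) * F t := by
  induction p using Polynomial.induction_on' with
  | add p q hp hq => simpa only [eval_add, add_mul] using hp.add hq
  | monomial k c => simpa only [eval_monomial, mul_assoc] using (hF.pow_mul k).const_mul c

theorem one_sub_conj_mul_ne_zero {a z : ℂ} (ha : ‖a‖ < 1) (hz : ‖z‖ ≤ 1) :
    1 - conj a * z ≠ 0 := by
  intro h
  have h1 : ‖conj a * z‖ = 1 := by rw [← sub_eq_zero.mp h, norm_one]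
  rw [norm_mul, RCLike.norm_conj] at h1
  nlinarith [norm_nonneg a, norm_nonneg z]

/-- For the quotient `G`, vanishing of the moments of `F = (1 - conj a z) G` makes each moment of
`G` equal to `conj a` times the next. Iterating bounds it by `‖a‖ ^ k` times the `L¹` norm of `G`,
which tends to `0`. -/
theorem IsHardy.div_one_sub {F : UnitAddCircle → ℂ} (hF : IsHardy F) {a : ℂ} (ha : ‖a‖ < 1) :
    IsHardy fun t => F t / (1 - conj a * pt t) := by
  have hne : ∀ t, 1 - conj a * pt t ≠ 0 := fun t =>
    one_sub_conj_mul_ne_zero ha (norm_pt t).le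
  have hcont : Continuous fun t => (1 - conj a * pt t)⁻¹ :=
    (continuous_const.sub (continuous_const.mul continuous_pt)).inv₀ hne
  set G : UnitAddCircle → ℂ := fun t => F t / (1 - conj a * pt t) with hG
  have hGi : Integrable G arc := by
    refine (integrable_continuous_mul hcont hF.1).congr (.of_forall fun t => ?_)
    simp only [hG]; rw [div_eq_mul_inv, mul_comm]
  have hint : ∀ n : ℕ, Integrable (fun t => pt t ^ n * G t) arc := fun n =>
    integrable_continuous_mul (continuous_pt.pow n) hGi
  have hrec : ∀ n : ℕ, ∫ t, pt t ^ (n + 1) * G t ∂arc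
      = conj a * ∫ t, pt t ^ (n + 2) * G t ∂arc := by
    intro n
    rw [← integral_const_mul, ← sub_eq_zero, ← integral_sub (hint _) ((hint _).const_mul _),
      ← hF.2 n]
    congr 1; ext t
    simp only [hG]
    field_simp [hne t]
    ring
  have hiter : ∀ k n : ℕ, ∫ t, pt t ^ (n + 1) * G t ∂arc
      = conj a ^ k * ∫ t, pt t ^ (n + k + 1) * G t ∂arc := by
    intro k
    induction k with
    | zero => intro n; simp
    | succ k ih => intro n; rw [ih, hrec (n + k)]; ring_nf
  refine ⟨hGi, fun n => ?_⟩
  have hbound : ∀ k : ℕ, ‖∫ t, pt t ^ (n + 1) * G t ∂arc‖ ≤ ‖a‖ ^ k * ∫ t, ‖G t‖ ∂arc := by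
    intro k
    rw [hiter k n, norm_mul, norm_pow, RCLike.norm_conj]
    gcongr
    refine (norm_integral_le_integral_norm _).trans_eq ?_
    simp [norm_pt]
  have hlim : Filter.Tendsto (fun k : ℕ => ‖a‖ ^ k * ∫ t, ‖G t‖ ∂arc) Filter.atTop (nhds 0) := by
    simpa using (tendsto_pow_atTop_nhds_zero_of_lt_one (norm_nonneg a) ha).mul_const
      (∫ t, ‖G t‖ ∂arc)
  exact norm_le_zero_iff.mp (ge_of_tendsto' hlim hbound)

/-! ### Numerator and denominator of a finite Blaschke product -/

/-- The polynomial `∏ (1 - conj a_j z)`. -/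
def den {m : ℕ} (a : Fin m → ℂ) : ℂ[X] := ∏ j, (1 - C (conj (a j)) * X)

/-- The polynomial `∏ (z - a_j)`. -/
def num {m : ℕ} (a : Fin m → ℂ) : ℂ[X] := ∏ j, (X - C (a j))

variable {m : ℕ} {a : Fin m → ℂ}

theorem eval_den (z : ℂ) : (den a).eval z = ∏ j, (1 - conj (a j) * z) := by
  simp [den, eval_prod]

theorem eval_num (z : ℂ) : (num a).eval z = ∏ j, (z - a j) := by
  simp [num, eval_prod]

theorem eval_den_ne_zero (ha : ∀ j, ‖a j‖ < 1) {z : ℂ} (hz : ‖z‖ ≤ 1) : (den a).eval z ≠ 0 := by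
  rw [eval_den]
  exact Finset.prod_ne_zero_iff.mpr fun j _ => one_sub_conj_mul_ne_zero (ha j) hz

theorem natDegree_num_le : (num a).natDegree ≤ m := by
  refine (natDegree_prod_le _ _).trans ?_
  simp

theorem natDegree_den_le : (den a).natDegree ≤ m := by
  refine (natDegree_prod_le _ _).trans ?_
  refine (Finset.sum_le_card_nsmul _ _ 1 fun j _ => ?_).trans (by simp)
  compute_degree

theorem num_ne_zero : num a ≠ 0 := Finset.prod_ne_zero_iff.mpr fun _ _ => X_sub_C_ne_zero _

theorem eval_num_eq (a : Fin m → ℂ) {z : ℂ} (hz : ‖z‖ = 1) :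
    (num a).eval z = z ^ m * conj ((den a).eval z) := by
  rw [eval_num, eval_den, map_prod]
  have : z ^ m = ∏ _j : Fin m, z := by simp
  rw [this, ← Finset.prod_mul_distrib]
  refine Finset.prod_congr rfl fun j _ => ?_
  simp only [map_sub, map_one, map_mul, Complex.conj_conj]
  linear_combination (a j) * mul_conj_of_norm_eq_one hz

theorem IsHardy.div_den {F : UnitAddCircle → ℂ} (hF : IsHardy F) (ha : ∀ j, ‖a j‖ < 1) :
    IsHardy fun t => F t / (den a).eval (pt t) := by
  have h : ∀ s : Finset (Fin m), IsHardy fun t => F t / ∏ j ∈ s, (1 - conj (a j) * pt t) := by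
    intro s
    induction s using Finset.induction_on with
    | empty => simpa using hF
    | insert j s hj ih =>
      refine (ih.div_one_sub (ha j)).congr (.of_forall fun t => ?_)
      simp only [Finset.prod_insert hj]
      rw [div_div, mul_comm]
  simpa only [eval_den] using h Finset.univ

/-- On the unit circle, `z ^ (m - 1) * conj (p z)` is a polynomial of degree less than `m`
if `p` is. -/
theorem exists_eval_eq_pow_mul_conj (p : ℂ[X]) (hp : p.degree < m) :
    ∃ q : ℂ[X], q.degree < m ∧ ∀ z : ℂ, ‖z‖ = 1 → q.eval z = z ^ (m - 1) * conj (p.eval z) := by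
  refine ⟨∑ k ∈ Finset.range m, monomial (m - 1 - k) (conj (p.coeff k)), ?_, fun z hz => ?_⟩
  · rw [← mem_degreeLT]
    refine Submodule.sum_mem _ fun k hk => ?_
    rw [mem_degreeLT]
    refine (degree_monomial_le _ _).trans_lt ?_
    have := Finset.mem_range.mp hk
    exact_mod_cast (by omega : m - 1 - k < m)
  · have hsum : p.eval z = ∑ k ∈ Finset.range m, p.coeff k * z ^ k := by
      rcases eq_or_ne p 0 with rfl | h0
      · simp
      · exact eval_eq_sum_range' ((natDegree_lt_iff_degree_lt h0).mpr hp) z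
    rw [hsum, map_sum, eval_finsetSum, Finset.mul_sum]
    refine Finset.sum_congr rfl fun k hk => ?_
    have hk' := Finset.mem_range.mp hk
    have h1 : z ^ (m - 1) = z ^ (m - 1 - k) * z ^ k := by rw [← pow_add]; congr 1; omega
    have h2 : z ^ k * conj z ^ k = 1 := by rw [← mul_pow, mul_conj_of_norm_eq_one hz, one_pow]
    rw [eval_monomial, map_mul, map_pow, h1]
    linear_combination (- conj (p.coeff k) * z ^ (m - 1 - k)) * h2

theorem eq_zero_of_eval_pt (p : ℂ[X]) (hp : ∀ᵐ t ∂arc, p.eval (pt t) = 0) : p = 0 := by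
  have h : (fun t => p.eval (pt t)) =ᵐ[arc] fun _ => 0 := hp
  have h' := (Continuous.ae_eq_iff_eq arc (p.continuous.comp continuous_pt)
    continuous_const).mp h
  refine p.eq_zero_of_infinite_isRoot ((Set.infinite_range_of_injective injective_pt).mono ?_)
  rintro _ ⟨t, rfl⟩
  exact congrFun h' t

/-! ### The model space of a finite Blaschke product -/

theorem inner_eq_integral (u v : L2) : inner ℂ u v = ∫ t, conj (u t) * v t ∂arc := by
  rw [L2.inner_def]
  congr 1; ext t
  rw [RCLike.inner_apply, mul_comm]

theorem continuous_ratio (ha : ∀ j, ‖a j‖ < 1) (p : ℂ[X]) :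
    Continuous fun t => p.eval (pt t) / (den a).eval (pt t) :=
  (p.continuous.comp continuous_pt).div ((den a).continuous.comp continuous_pt)
    fun t => eval_den_ne_zero ha (norm_pt t).le

/-- The element `p / ∏ (1 - conj a_j z)` of `L²(∂𝔻)`, as a linear function of `p`. -/
def ratio (ha : ∀ j, ‖a j‖ < 1) : ℂ[X] →ₗ[ℂ] L2 where
  toFun p := (memLp_of_continuous (continuous_ratio ha p) 2).toLp _
  map_add' p q := by
    rw [← MemLp.toLp_add]
    congr 1; ext t
    simp [add_div]
  map_smul' c p := by
    rw [RingHom.id_apply, ← MemLp.toLp_const_smul]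
    congr 1; ext t
    simp [mul_div_assoc]

theorem coeFn_ratio (ha : ∀ j, ‖a j‖ < 1) (p : ℂ[X]) :
    ∀ᵐ t ∂arc, ratio ha p t = p.eval (pt t) / (den a).eval (pt t) :=
  (memLp_of_continuous (continuous_ratio ha p) 2).coeFn_toLp

theorem memLp_ratio (ha : ∀ j, ‖a j‖ < 1) (p : ℂ[X]) : MemLp (ratio ha p) ∞ arc :=
  (memLp_congr_ae (coeFn_ratio ha p)).mpr (memLp_of_continuous (continuous_ratio ha p) ∞)

theorem isHardy_ratio (ha : ∀ j, ‖a j‖ < 1) (p : ℂ[X]) : IsHardy (ratio ha p) := by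
  refine ((isHardy_one.eval_mul p).div_den ha).congr ?_
  filter_upwards [coeFn_ratio ha p] with t ht
  rw [ht, mul_one]

/-- `α` is the Blaschke product with unimodular constant `c` and zeros `a` in the disk. -/
structure IsBlaschke (c : ℂ) (a : Fin m → ℂ) (α : ℂ → ℂ) : Prop where
  norm_const : ‖c‖ = 1
  norm_zero_lt : ∀ j, ‖a j‖ < 1
  apply_eq : ∀ z : ℂ, ‖z‖ ≤ 1 → α z = c * ((num a).eval z / (den a).eval z)

theorem IsFiniteBlaschke.exists_isBlaschke {α : ℂ → ℂ} (h : IsFiniteBlaschke m α) :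
    ∃ (c : ℂ) (a : Fin m → ℂ), IsBlaschke c a α := by
  obtain ⟨c, a, hc, ha, h⟩ := h
  refine ⟨c, a, hc, ha, fun z hz => ?_⟩
  rw [h z hz, Finset.prod_div_distrib, eval_num, eval_den]

variable {c : ℂ} {α : ℂ → ℂ}

namespace IsBlaschke

theorem den_ne_zero (h : IsBlaschke c a α) (t : UnitAddCircle) : (den a).eval (pt t) ≠ 0 :=
  eval_den_ne_zero h.norm_zero_lt (norm_pt t).le

theorem apply_pt (h : IsBlaschke c a α) (t : UnitAddCircle) :
    α (pt t) = c * (pt t ^ m * conj ((den a).eval (pt t)) / (den a).eval (pt t)) := by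
  rw [h.apply_eq _ (norm_pt t).le, eval_num_eq a (norm_pt t)]

theorem norm_apply_pt (h : IsBlaschke c a α) (t : UnitAddCircle) : ‖α (pt t)‖ = 1 := by
  have := norm_ne_zero_iff.mpr (h.den_ne_zero t)
  rw [h.apply_pt, norm_mul, h.norm_const, norm_div, norm_mul, norm_pow, norm_pt, RCLike.norm_conj]
  simp [this]

theorem continuous_apply_pt (h : IsBlaschke c a α) : Continuous fun t => α (pt t) := by
  simp_rw [fun t => h.apply_eq _ (norm_pt t).le]
  exact continuous_const.mul (continuous_ratio h.norm_zero_lt _)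

/-- On the circle `α * conj (p / den) = c z q / den`, where `q` is `p` reversed with conjugated
coefficients. The pairing with `α u` is thus, up to conjugation, the coefficient of index `-1` of
the Hardy function `c q u / den`. -/
theorem ratio_mem_K (h : IsBlaschke c a α) (hm : 0 < m) {p : ℂ[X]} (hp : p.degree < m) :
    ratio h.norm_zero_lt p ∈ K α := by
  refine ⟨(mem_hardy_iff_isHardy _).mpr (isHardy_ratio _ p), ?_⟩
  rw [SetLike.mem_coe, Submodule.mem_orthogonal]
  rintro v ⟨u, hu, huv⟩
  obtain ⟨q, -, hq⟩ := exists_eval_eq_pow_mul_conj p hp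
  have hH := ((((mem_hardy_iff_isHardy u).mp hu).eval_mul q).div_den h.norm_zero_lt).const_mul c
  have h0 := congrArg conj (hH.2 0)
  rw [← integral_conj, map_zero] at h0
  rw [inner_eq_integral, ← h0]
  refine integral_congr_ae ?_
  filter_upwards [huv, coeFn_ratio h.norm_zero_lt p] with t h1 h2
  have hd := h.den_ne_zero t
  have hd' := (map_ne_zero (starRingEnd ℂ)).mpr hd
  have hz : conj (pt t) ^ (m - 1) * conj (pt t) = conj (pt t) ^ m := by
    rw [← pow_succ]; congr 1; omega
  rw [h1, h2, h.apply_pt, hq _ (norm_pt t)]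
  simp only [map_mul, map_div₀, map_pow, Complex.conj_conj, zero_add, pow_one, ← hz]
  field_simp

/-- The function `v = den * u` has no Fourier coefficients of negative index since `u` is in `H²`,
and none of index at least `m` since `u ⊥ αH²`; so it is a polynomial of degree less than `m`. -/
theorem exists_eq_ratio (h : IsBlaschke c a α) {u : L2} (hu : u ∈ K α) :
    ∃ p : ℂ[X], p.degree < m ∧ u = ratio h.norm_zero_lt p := by
  have hdc : Continuous fun t => (den a).eval (pt t) := (den a).continuous.comp continuous_pt
  have hvL : MemLp (fun t => (den a).eval (pt t) * u t) 2 arc :=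
    (Lp.memLp u).mul (memLp_of_continuous hdc ∞)
  set v : L2 := hvL.toLp _
  have hve : ∀ᵐ t ∂arc, v t = (den a).eval (pt t) * u t := hvL.coeFn_toLp
  have hneg : ∀ n : ℤ, n < 0 → fourierCoeff v n = 0 := by
    rw [← mem_hardy_iff, mem_hardy_iff_isHardy]
    exact (((mem_hardy_iff_isHardy u).mp hu.1).eval_mul (den a)).congr (Filter.EventuallyEq.symm hve)
  have hlarge : ∀ k : ℕ, fourierCoeff v ((m + k : ℕ) : ℤ) = 0 := by
    intro k
    -- This test function is chosen so that multiplying it by `α` gives `z ^ (m + k) * conj den`,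
    -- whose pairing with `u` is the coefficient of `v` of index `m + k`.
    have hcont : Continuous fun t => pt t ^ k * (conj c * (den a).eval (pt t)) :=
      (continuous_pt.pow k).mul (continuous_const.mul hdc)
    set x : L2 := (memLp_of_continuous hcont 2).toLp _
    have hxe : ∀ᵐ t ∂arc, x t = pt t ^ k * (conj c * (den a).eval (pt t)) := MemLp.coeFn_toLp _
    have hxH : x ∈ hardy := by
      rw [mem_hardy_iff_isHardy]
      refine (((isHardy_one.eval_mul (den a)).const_mul (conj c)).pow_mul k).congr ?_
      filter_upwards [hxe] with t ht
      rw [ht, mul_one]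
    have hycont := h.continuous_apply_pt.mul hcont
    set y : L2 := (memLp_of_continuous hycont 2).toLp _
    have hye : ∀ᵐ t ∂arc, y t = α (pt t) * (pt t ^ k * (conj c * (den a).eval (pt t))) :=
      MemLp.coeFn_toLp _
    have hyM : y ∈ mulHardy α := by
      refine ⟨x, hxH, ?_⟩
      filter_upwards [hxe, hye] with t h1 h2
      rw [h1, h2]
    have h0 := (Submodule.mem_orthogonal _ _).mp hu.2 y hyM
    rw [inner_eq_integral] at h0
    rw [fourierCoeff_eq_integral_pt, ← h0]
    refine integral_congr_ae ?_
    filter_upwards [hye, hve] with t h1 h2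
    have hd := h.den_ne_zero t
    have hc := mul_conj_of_norm_eq_one h.norm_const
    have hz : pt t ^ (-((m + k : ℕ) : ℤ)) = conj (pt t) ^ (m + k) := by
      rw [zpow_neg, zpow_natCast, ← inv_pow,
        eq_inv_of_mul_eq_one_right (mul_conj_of_norm_eq_one (norm_pt t))]
    have hα : α (pt t) * (pt t ^ k * (conj c * (den a).eval (pt t)))
        = pt t ^ (m + k) * conj ((den a).eval (pt t)) := by
      rw [h.apply_pt]
      field_simp
      linear_combination (pt t ^ (m + k) * conj ((den a).eval (pt t))) * hc
    rw [h1, h2, hα, hz]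
    simp only [map_mul, map_pow, Complex.conj_conj]
    ring
  have hsum : v = ∑ k ∈ Finset.range m, fourierCoeff v (k : ℤ) • (fourierLp 2 (k : ℤ) : L2) := by
    refine (hasSum_fourier_series_L2 v).unique ?_
    have := hasSum_sum_of_ne_finset_zero (L := .unconditional ℤ)
      (f := fun i : ℤ => fourierCoeff v i • (fourierLp 2 i : L2))
      (s := (Finset.range m).map Nat.castEmbedding) ?_
    · simpa using this
    · intro n hn
      rcases lt_or_ge n 0 with h' | h'
      · simp only [hneg n h', zero_smul]
      · obtain ⟨k, rfl⟩ := Int.eq_ofNat_of_zero_le h'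
        have hk : m ≤ k := by
          by_contra hk
          exact hn (Finset.mem_map.mpr ⟨k, Finset.mem_range.mpr (not_le.mp hk), rfl⟩)
        obtain ⟨l, rfl⟩ := Nat.exists_eq_add_of_le hk
        simp only [hlarge l, zero_smul]
  refine ⟨∑ k ∈ Finset.range m, monomial k (fourierCoeff v (k : ℤ)), ?_, ?_⟩
  · rw [← mem_degreeLT]
    refine Submodule.sum_mem _ fun k hk => ?_
    rw [mem_degreeLT]
    refine (degree_monomial_le _ _).trans_lt ?_
    exact_mod_cast Finset.mem_range.mp hk
  · apply Lp.ext
    have hvp : ∀ᵐ t ∂arc, v t = ∑ k ∈ Finset.range m, fourierCoeff v (k : ℤ) * pt t ^ k := by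
      have h1 : ∀ᵐ t ∂arc, ∀ k : ℕ, (fourierCoeff v (k : ℤ) • (fourierLp 2 (k : ℤ) : L2)) t
          = fourierCoeff v (k : ℤ) * pt t ^ k := by
        rw [ae_all_iff]
        intro k
        filter_upwards [Lp.coeFn_smul (fourierCoeff v (k : ℤ)) (fourierLp 2 (k : ℤ) : L2),
          coeFn_fourierLp (T := 1) 2 (k : ℤ)] with t h1 h2
        rw [h1, Pi.smul_apply, h2, smul_eq_mul, fourier_eq_pt_zpow, zpow_natCast]
      have h2 := Lp.coeFn_finsetSum (μ := arc) (p := 2) (Finset.range m)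
        (fun k : ℕ => fourierCoeff v (k : ℤ) • (fourierLp 2 (k : ℤ) : L2))
      rw [← hsum] at h2
      filter_upwards [h1, h2] with t h1 h2
      rw [h2, Finset.sum_apply]
      exact Finset.sum_congr rfl fun k _ => h1 k
    filter_upwards [hvp, hve, coeFn_ratio h.norm_zero_lt
      (∑ k ∈ Finset.range m, monomial k (fourierCoeff v (k : ℤ)))] with t h1 h2 h3
    rw [h3, eval_finsetSum, eq_div_iff (h.den_ne_zero t), mul_comm, ← h2, h1]
    simp only [eval_monomial]

/-- The basis element `z ^ k / ∏ (1 - conj a_j z)` of the model space. -/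
def mono (h : IsBlaschke c a α) (k : ℕ) : L2 := ratio h.norm_zero_lt (X ^ k)

theorem coeFn_mono (h : IsBlaschke c a α) (k : ℕ) :
    ∀ᵐ t ∂arc, h.mono k t = pt t ^ k / (den a).eval (pt t) := by
  filter_upwards [coeFn_ratio h.norm_zero_lt (X ^ k)] with t ht
  rw [mono, ht, eval_pow, eval_X]

theorem mono_mem_K (h : IsBlaschke c a α) {k : ℕ} (hk : k < m) : h.mono k ∈ K α :=
  h.ratio_mem_K (by omega) (by rw [degree_X_pow]; exact_mod_cast hk)

theorem memLp_mono (h : IsBlaschke c a α) (k : ℕ) : MemLp (h.mono k) ∞ arc := memLp_ratio _ _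

theorem eq_zero_of_inner_mono (h : IsBlaschke c a α) {u : L2} (hu : u ∈ K α)
    (h0 : ∀ k < m, inner ℂ u (h.mono k) = 0) : u = 0 := by
  obtain ⟨p, hp, rfl⟩ := h.exists_eq_ratio hu
  set u := ratio h.norm_zero_lt p
  have hle : degreeLT ℂ m ≤ LinearMap.ker ((innerSL ℂ u).toLinearMap ∘ₗ ratio h.norm_zero_lt) := by
    rw [degreeLT_eq_span_X_pow, Submodule.span_le]
    intro q hq
    obtain ⟨k, hk, rfl⟩ := Finset.mem_image.mp (Finset.mem_coe.mp hq)
    exact h0 k (Finset.mem_range.mp hk)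
  exact inner_self_eq_zero.mp (hle (mem_degreeLT.mpr hp) : inner ℂ u u = 0)

/-! ### Vanishing integrals of the basis elements -/

theorem integral_mono_succ (h : IsBlaschke c a α) (k : ℕ) : ∫ t, h.mono (k + 1) t ∂arc = 0 := by
  rw [← (isHardy_one.div_den h.norm_zero_lt).2 k]
  refine integral_congr_ae ?_
  filter_upwards [h.coeFn_mono (k + 1)] with t ht
  rw [ht, mul_one_div]

theorem integrable_conj_mul_mono (h : IsBlaschke c a α) (k : ℕ) :
    Integrable (fun t => conj (α (pt t)) * h.mono k t) arc :=
  integrable_continuous_mul (Complex.continuous_conj.comp h.continuous_apply_pt) (integrable_L2 _)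

/-- This is orthogonality to `α = α * 1`, an element of `αH²`. -/
theorem integral_conj_mul_mono (h : IsBlaschke c a α) {k : ℕ} (hk : k < m) :
    ∫ t, conj (α (pt t)) * h.mono k t ∂arc = 0 := by
  set y : L2 := (memLp_of_continuous h.continuous_apply_pt 2).toLp _
  have hy : ∀ᵐ t ∂arc, y t = α (pt t) := MemLp.coeFn_toLp _
  set x : L2 := (memLp_of_continuous (continuous_const (y := (1 : ℂ))) 2).toLp _
  have hx : ∀ᵐ t ∂arc, x t = 1 := MemLp.coeFn_toLp _
  have hyM : y ∈ mulHardy α := by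
    refine ⟨x, (mem_hardy_iff_isHardy x).mpr (isHardy_one.congr (Filter.EventuallyEq.symm hx)), ?_⟩
    filter_upwards [hx, hy] with t h1 h2
    rw [h1, h2, mul_one]
  have h0 := (Submodule.mem_orthogonal _ _).mp (h.mono_mem_K hk).2 y hyM
  rw [inner_eq_integral] at h0
  rw [← h0]
  refine integral_congr_ae ?_
  filter_upwards [hy] with t ht
  rw [ht]

theorem integral_combination (h : IsBlaschke c a α) (x y : ℂ) {k : ℕ} (hk : k + 1 < m) :
    ∫ t, (x + y * conj (α (pt t))) * h.mono (k + 1) t ∂arc = 0 := by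
  simp_rw [add_mul, mul_assoc]
  rw [integral_add ((integrable_L2 _).const_mul x) ((h.integrable_conj_mul_mono _).const_mul y),
    integral_const_mul, integral_const_mul, h.integral_mono_succ, h.integral_conj_mul_mono hk]
  simp

/-! ### The kernels -/

/-- The numerator `N = c * num - α(w) * den` of `α - α(w)` vanishes at `w`, so `X - w` divides it,
also when `|w| = 1`. -/
theorem exists_conjKernel_eq (h : IsBlaschke c a α) (hm : 0 < m) {w : ℂ} (hw : ‖w‖ ≤ 1) :
    ∃ p : ℂ[X], p.degree < m ∧ p ≠ 0 ∧ ∀ t, pt t ≠ w →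
      conjKernel α w (pt t) = p.eval (pt t) / (den a).eval (pt t) := by
  set N : ℂ[X] := C c * num a - C (α w) * den a with hN
  have hdw := eval_den_ne_zero h.norm_zero_lt hw
  have hc : c ≠ 0 := norm_ne_zero_iff.mp (by rw [h.norm_const]; exact one_ne_zero)
  have hroot : N.IsRoot w := by
    simp only [hN, IsRoot.def, eval_sub, eval_mul, eval_C, h.apply_eq w hw]
    field_simp
    ring
  -- If `N = 0`, evaluation at a zero of `α` forces `α w = 0`, and then `N = c * num`, which is
  -- nonzero.
  have hN0 : N ≠ 0 := by
    intro h0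
    have h1 := congrArg (eval (a ⟨0, hm⟩)) h0
    have h2 : (num a).eval (a ⟨0, hm⟩) = 0 := by
      rw [eval_num]
      exact Finset.prod_eq_zero (Finset.mem_univ _) (sub_self _)
    have hα : α w = 0 := by
      simpa [hN, h2, eval_den_ne_zero h.norm_zero_lt (h.norm_zero_lt ⟨0, hm⟩).le] using h1
    rw [hN, hα, C_0, zero_mul, sub_zero] at h0
    exact mul_ne_zero (C_ne_zero.mpr hc) num_ne_zero h0
  have hmul := mul_divByMonic_eq_iff_isRoot.mpr hroot
  have hdeg : N.natDegree ≤ m := by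
    refine (natDegree_sub_le _ _).trans (max_le ?_ ?_)
    · exact (natDegree_C_mul_le _ _).trans natDegree_num_le
    · exact (natDegree_C_mul_le _ _).trans natDegree_den_le
  refine ⟨N /ₘ (X - C w), ?_, ?_, fun t ht => ?_⟩
  · refine degree_le_natDegree.trans_lt ?_
    rw [natDegree_divByMonic _ (monic_X_sub_C w), natDegree_X_sub_C]
    exact_mod_cast (by omega : N.natDegree - 1 < m)
  · intro h0
    rw [h0, mul_zero] at hmul
    exact hN0 hmul.symm
  · have hd := h.den_ne_zero t
    have he := congrArg (eval (pt t)) hmul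
    simp only [eval_mul, eval_sub, eval_X, eval_C, hN] at he
    rw [conjKernel_eq α w _ (norm_pt t) (h.norm_apply_pt t),
      div_eq_div_iff (sub_ne_zero.mpr ht) hd, mul_comm (eval _ (_ /ₘ _)), he,
      h.apply_eq _ (norm_pt t).le]
    field_simp

theorem kernel_eq_conjugation (h : IsBlaschke c a α) (w : ℂ) (t : UnitAddCircle) :
    kernel α w (pt t) = conjugation α (conjKernel α w) (pt t) := by
  have h1 := mul_conj_of_norm_eq_one (norm_pt t)
  have h2 := mul_conj_of_norm_eq_one (h.norm_apply_pt t)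
  simp only [conjKernel, conjugation, map_mul, Complex.conj_conj]
  linear_combination (-kernel α w (pt t)) * (h1 + pt t * conj (pt t) * h2)

theorem exists_conjKernel_coeFn (h : IsBlaschke c a α) (hm : 0 < m) {w : ℂ} (hw : ‖w‖ ≤ 1) :
    ∃ x ∈ K α, x ≠ 0 ∧ ∀ᵐ t ∂arc, x t = conjKernel α w (pt t) := by
  obtain ⟨p, hp, hp0, hpe⟩ := h.exists_conjKernel_eq hm hw
  refine ⟨ratio h.norm_zero_lt p, h.ratio_mem_K hm hp, fun h0 => hp0 (eq_zero_of_eval_pt p ?_), ?_⟩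
  · filter_upwards [coeFn_ratio h.norm_zero_lt p, Lp.coeFn_zero ℂ 2 arc] with t h1 h2
    rw [h0, h2, Pi.zero_apply, eq_comm, div_eq_zero_iff] at h1
    exact h1.resolve_right (h.den_ne_zero t)
  · filter_upwards [coeFn_ratio h.norm_zero_lt p, ae_pt_ne w] with t h1 h2
    rw [h1, hpe t h2]

/-- The conjugation sends `p / den` to `c q / den`, with `q` the conjugate reversal of `p`; apply
this to the conjugate kernel. -/
theorem exists_kernel_coeFn (h : IsBlaschke c a α) (hm : 0 < m) {w : ℂ} (hw : ‖w‖ ≤ 1) :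
    ∃ x ∈ K α, x ≠ 0 ∧ ∀ᵐ t ∂arc, x t = kernel α w (pt t) := by
  obtain ⟨p, hp, hp0, hpe⟩ := h.exists_conjKernel_eq hm hw
  obtain ⟨q, hq, hqe⟩ := exists_eval_eq_pow_mul_conj p hp
  have hc : c ≠ 0 := norm_ne_zero_iff.mp (by rw [h.norm_const]; exact one_ne_zero)
  refine ⟨c • ratio h.norm_zero_lt q, (K α).smul_mem c (h.ratio_mem_K hm hq), fun h0 => ?_, ?_⟩
  · have h0' := (smul_eq_zero.mp h0).resolve_left hc
    refine hp0 (eq_zero_of_eval_pt p ?_)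
    filter_upwards [coeFn_ratio h.norm_zero_lt q, Lp.coeFn_zero ℂ 2 arc] with t h1 h2
    rw [h0', h2, Pi.zero_apply, eq_comm, div_eq_zero_iff, hqe _ (norm_pt t)] at h1
    have h3 := (mul_eq_zero.mp (h1.resolve_right (h.den_ne_zero t))).resolve_left
      (pow_ne_zero _ (pt_ne_zero t))
    exact (map_eq_zero _).mp h3
  · filter_upwards [coeFn_ratio h.norm_zero_lt q, ae_pt_ne w,
      Lp.coeFn_smul c (ratio h.norm_zero_lt q)] with t h1 h2 h3
    have hd := h.den_ne_zero t
    have hd' := (map_ne_zero (starRingEnd ℂ)).mpr hd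
    have hz : pt t ^ m = pt t ^ (m - 1) * pt t := by rw [← pow_succ]; congr 1; omega
    rw [h3, Pi.smul_apply, h1, smul_eq_mul, h.kernel_eq_conjugation, conjugation, hpe t h2,
      h.apply_pt, hqe _ (norm_pt t), hz, map_div₀]
    field_simp
    linear_combination (-(pt t ^ (m - 1)) * conj (p.eval (pt t))) *
      mul_conj_of_norm_eq_one (norm_pt t)

/-! ### Kernels characterised by their moments -/

/-- The factor `z - w` cancels the conjugated denominator `1 - w * conj z = (z - w) / z`, leaving an
integral covered by `integral_combination`. -/
theorem inner_kernel_mono (h : IsBlaschke c a α) {w : ℂ} {x : L2}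
    (hx : ∀ᵐ t ∂arc, x t = kernel α w (pt t)) {k : ℕ} (hk : k + 1 < m) :
    inner ℂ x (h.mono (k + 1) - w • h.mono k) = 0 := by
  rw [inner_eq_integral, ← h.integral_combination 1 (-α w) hk]
  refine integral_congr_ae ?_
  filter_upwards [hx, h.coeFn_mono k, h.coeFn_mono (k + 1), ae_pt_ne w, Lp.coeFn_smul w (h.mono k),
    Lp.coeFn_sub (h.mono (k + 1)) (w • h.mono k)] with t h1 h2 h3 h4 h5 h6
  have hz := mul_conj_of_norm_eq_one (norm_pt t)
  have hd := h.den_ne_zero t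
  have hw : pt t - w ≠ 0 := sub_ne_zero.mpr h4
  have hi : 1 - w * conj (pt t) = (pt t - w) * (pt t)⁻¹ := by
    rw [eq_inv_of_mul_eq_one_right hz, sub_mul, mul_inv_cancel₀ (pt_ne_zero t)]
  have hp := pt_ne_zero t
  rw [h6, Pi.sub_apply, h5, Pi.smul_apply, h1, h2, h3, kernel, smul_eq_mul]
  simp only [map_div₀, map_sub, map_one, map_mul, Complex.conj_conj]
  rw [hi]
  field_simp
  ring

/-- Here `z^k - conj w * z^(k+1) = z^(k+1) * (conj z - conj w)` cancels the conjugated denominator.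
-/
theorem inner_conjKernel_mono (h : IsBlaschke c a α) {w : ℂ} {x : L2}
    (hx : ∀ᵐ t ∂arc, x t = conjKernel α w (pt t)) {k : ℕ} (hk : k + 1 < m) :
    inner ℂ x (h.mono k - conj w • h.mono (k + 1)) = 0 := by
  rw [inner_eq_integral, ← h.integral_combination (-conj (α w)) 1 hk]
  refine integral_congr_ae ?_
  filter_upwards [hx, h.coeFn_mono k, h.coeFn_mono (k + 1), ae_pt_ne w,
    Lp.coeFn_smul (conj w) (h.mono (k + 1)),
    Lp.coeFn_sub (h.mono k) (conj w • h.mono (k + 1))] with t h1 h2 h3 h4 h5 h6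
  have hz := mul_conj_of_norm_eq_one (norm_pt t)
  have hd := h.den_ne_zero t
  have hw : conj (pt t) - conj w ≠ 0 := by
    rw [← map_sub]
    exact (map_ne_zero (starRingEnd ℂ)).mpr (sub_ne_zero.mpr h4)
  rw [h6, Pi.sub_apply, h5, Pi.smul_apply, h1, h2, h3,
    conjKernel_eq α w _ (norm_pt t) (h.norm_apply_pt t), smul_eq_mul]
  simp only [map_div₀, map_sub]
  field_simp
  linear_combination (-(conj (α (pt t)) - conj (α w)) * pt t ^ k) * hz

/-- By `hsep`, pairing with `e` is injective on the subspace of `K α` orthogonal to all `v k`, so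
this subspace is at most a line; it contains `x ≠ 0`. -/
theorem isScalarMultiple_iff_of_separating {x e : L2} {v : ℕ → L2} {φ : ℂ → ℂ}
    (hxK : x ∈ K α) (hx0 : x ≠ 0) (hxφ : ∀ᵐ t ∂arc, x t = φ (pt t))
    (hxv : ∀ k, k + 1 < m → inner ℂ x (v k) = 0)
    (hsep : ∀ u ∈ K α, (∀ k, k + 1 < m → inner ℂ u (v k) = 0) → inner ℂ u e = 0 → u = 0)
    {u : L2} (hu : u ∈ K α) :
    IsScalarMultiple u φ ↔ ∀ k, k + 1 < m → inner ℂ u (v k) = 0 := by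
  constructor
  · rintro ⟨d, hd⟩ k hk
    have : u = d • x := by
      apply Lp.ext
      filter_upwards [hd, hxφ, Lp.coeFn_smul d x] with t h1 h2 h3
      rw [h1, h3, Pi.smul_apply, h2, smul_eq_mul]
    rw [this, inner_smul_left, hxv k hk, mul_zero]
  · intro h
    have hxe : inner ℂ x e ≠ 0 := fun h0 => hx0 (hsep x hxK hxv h0)
    set d : ℂ := conj (inner ℂ u e / inner ℂ x e) with hd
    have h0 : u - d • x = 0 := by
      refine hsep _ ((K α).sub_mem hu ((K α).smul_mem d hxK)) (fun k hk => ?_) ?_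
      · rw [inner_sub_left, inner_smul_left, h k hk, hxv k hk, mul_zero, sub_zero]
      · rw [inner_sub_left, inner_smul_left, hd, Complex.conj_conj, div_mul_cancel₀ _ hxe, sub_self]
    refine ⟨d, ?_⟩
    rw [sub_eq_zero.mp h0]
    filter_upwards [hxφ, Lp.coeFn_smul d x] with t h2 h3
    rw [h3, Pi.smul_apply, h2, smul_eq_mul]

theorem isScalarMultiple_kernel_iff (h : IsBlaschke c a α) (hm : 0 < m) {w : ℂ} (hw : ‖w‖ ≤ 1)
    {u : L2} (hu : u ∈ K α) : IsScalarMultiple u (kernel α w) ↔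
      ∀ k, k + 1 < m → inner ℂ u (h.mono (k + 1)) = w * inner ℂ u (h.mono k) := by
  obtain ⟨x, hxK, hx0, hxe⟩ := h.exists_kernel_coeFn hm hw
  have hiff : ∀ (u : L2) (k : ℕ), inner ℂ u (h.mono (k + 1) - w • h.mono k) = 0 ↔
      inner ℂ u (h.mono (k + 1)) = w * inner ℂ u (h.mono k) := fun u k => by
    rw [inner_sub_right, inner_smul_right, sub_eq_zero]
  rw [isScalarMultiple_iff_of_separating (m := m) (e := h.mono 0)
    (v := fun k => h.mono (k + 1) - w • h.mono k) hxK hx0 hxe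
    (fun k hk => h.inner_kernel_mono hxe hk) ?_ hu]
  · simp only [hiff]
  · intro u hu hv h0
    simp only [hiff] at hv
    refine h.eq_zero_of_inner_mono hu fun k => ?_
    induction k with
    | zero => exact fun _ => h0
    | succ k ih => intro hk; rw [hv k hk, ih (by omega), mul_zero]

theorem isScalarMultiple_conjKernel_iff (h : IsBlaschke c a α) (hm : 0 < m) {w : ℂ}
    (hw : ‖w‖ ≤ 1) {u : L2} (hu : u ∈ K α) : IsScalarMultiple u (conjKernel α w) ↔
      ∀ k, k + 1 < m → inner ℂ u (h.mono k) = conj w * inner ℂ u (h.mono (k + 1)) := by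
  obtain ⟨x, hxK, hx0, hxe⟩ := h.exists_conjKernel_coeFn hm hw
  have hiff : ∀ (u : L2) (k : ℕ), inner ℂ u (h.mono k - conj w • h.mono (k + 1)) = 0 ↔
      inner ℂ u (h.mono k) = conj w * inner ℂ u (h.mono (k + 1)) := fun u k => by
    rw [inner_sub_right, inner_smul_right, sub_eq_zero]
  rw [isScalarMultiple_iff_of_separating (m := m) (e := h.mono (m - 1))
    (v := fun k => h.mono k - conj w • h.mono (k + 1)) hxK hx0 hxe
    -- The separating vector is the top basis element: this recurrence determines moments downwards,
    -- and for `w = 0` it could not be run upwards.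
    (fun k hk => h.inner_conjKernel_mono hxe hk) ?_ hu]
  · simp only [hiff]
  · intro u hu hv h0
    simp only [hiff] at hv
    have key : ∀ l, l < m → inner ℂ u (h.mono (m - 1 - l)) = 0 := by
      intro l
      induction l with
      | zero => exact fun _ => h0
      | succ l ih =>
        intro hl
        have hs : m - 1 - (l + 1) + 1 = m - 1 - l := by omega
        rw [hv _ (by omega), hs, ih (by omega), mul_zero]
    refine h.eq_zero_of_inner_mono hu fun k hk => ?_
    have := key (m - 1 - k) (by omega)
    rwa [Nat.sub_sub_self (by omega)] at this

end IsBlaschke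

/-! ### Rank-one truncated Toeplitz operators -/

/-- Both sides are the matrix entry of `g ⊗ f` at basis elements; these are bounded, so the symbol
formula applies, and the projection drops out against `K β`. -/
theorem inner_mul_inner_of_mem_attOperators {n : ℕ} {b : Fin n → ℂ} {d : ℂ} {β : ℂ → ℂ}
    (h : IsBlaschke c a α) (h' : IsBlaschke d b β) {f : K α} {g : K β}
    (hgf : InnerProductSpace.rankOne ℂ g f ∈ attOperators α β) :
    ∃ φ : L2, ∀ k < m, ∀ l < n, inner ℂ (f : L2) (h.mono k) * inner ℂ (h'.mono l) (g : L2)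
      = ∫ t, conj (h'.mono l t) * (φ t * h.mono k t) ∂arc := by
  obtain ⟨φ, hφ⟩ := hgf
  refine ⟨φ, fun k hk l hl => ?_⟩
  have h1 := congrArg (fun y : K β => inner ℂ (⟨h'.mono l, h'.mono_mem_K hl⟩ : K β) y)
    (hφ ⟨h.mono k, h.mono_mem_K hk⟩ (h.memLp_mono k))
  simp only [InnerProductSpace.rankOne_apply, inner_smul_right] at h1
  rw [Submodule.inner_orthogonalProjectionOnto_eq_of_mem_left, Submodule.coe_inner,
    Submodule.coe_inner] at h1
  rw [h1, inner_eq_integral]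
  refine integral_congr_ae ?_
  have h2 : ∀ᵐ t ∂arc, mulBdd φ (h.mono k) (h.memLp_mono k) t = φ t * h.mono k t :=
    MemLp.coeFn_toLp _
  filter_upwards [h2] with t ht
  rw [ht]

theorem inner_mul_inner_succ_of_mem_attOperators {n : ℕ} {b : Fin n → ℂ} {d : ℂ} {β : ℂ → ℂ}
    (h : IsBlaschke c a α) (h' : IsBlaschke d b β) {f : K α} {g : K β}
    (hgf : InnerProductSpace.rankOne ℂ g f ∈ attOperators α β) {k l : ℕ}
    (hk : k + 1 < m) (hl : l + 1 < n) :
    inner ℂ (f : L2) (h.mono (k + 1)) * inner ℂ (h'.mono (l + 1)) (g : L2)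
      = inner ℂ (f : L2) (h.mono k) * inner ℂ (h'.mono l) (g : L2) := by
  obtain ⟨φ, hφ⟩ := inner_mul_inner_of_mem_attOperators h h' hgf
  rw [hφ _ hk _ hl, hφ k (by omega) l (by omega)]
  refine integral_congr_ae ?_
  filter_upwards [h.coeFn_mono k, h.coeFn_mono (k + 1), h'.coeFn_mono l,
    h'.coeFn_mono (l + 1)] with t h1 h2 h3 h4
  rw [h1, h2, h3, h4]
  simp only [map_div₀, map_pow]
  linear_combination (conj (pt t) ^ l / conj ((den b).eval (pt t)) *
    (φ t * (pt t ^ k / (den a).eval (pt t)))) * mul_conj_of_norm_eq_one (norm_pt t)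

/-- If the products `x k * y l` of two nonzero finite sequences depend on `k - l` only, then `y`
is geometric with ratio `r` if and only if `x` read backwards is. -/
theorem geometric_iff_of_mul_succ {m n : ℕ} (hm : 1 < m) (hn : 1 < n) {x y : ℕ → ℂ}
    (hxy : ∀ k l, k + 1 < m → l + 1 < n → x (k + 1) * y (l + 1) = x k * y l)
    (hx : ∃ k < m, x k ≠ 0) (hy : ∃ l < n, y l ≠ 0) (r : ℂ) :
    (∀ l, l + 1 < n → y (l + 1) = r * y l) ↔ ∀ k, k + 1 < m → x k = r * x (k + 1) := by
  constructor
  · intro h k hk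
    -- Cancellation needs a nonzero term other than the last; by the recurrence, a nonzero last term
    -- has a nonzero predecessor.
    obtain ⟨l, hl, hl0⟩ : ∃ l, l + 1 < n ∧ y l ≠ 0 := by
      obtain ⟨l, hl, hl0⟩ := hy
      rcases lt_or_ge (l + 1) n with h1 | h1
      · exact ⟨l, h1, hl0⟩
      · obtain ⟨i, rfl⟩ : ∃ i, l = i + 1 := ⟨l - 1, by omega⟩
        exact ⟨i, hl, fun h0 => hl0 (by rw [h i hl, h0, mul_zero])⟩
    refine mul_right_cancel₀ hl0 ?_
    rw [← hxy k l hk hl, h l hl]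
    ring
  · intro h l hl
    obtain ⟨k, hk, hk0⟩ : ∃ k, k + 1 < m ∧ x (k + 1) ≠ 0 := by
      obtain ⟨k, hk, hk0⟩ := hx
      rcases k with _ | i
      · exact ⟨0, hm, fun h0 => hk0 (by rw [h 0 hm, h0, mul_zero])⟩
      · exact ⟨i, hk, hk0⟩
    refine mul_left_cancel₀ hk0 ?_
    rw [hxy k l hk hl, h k hk]
    ring

end ModelSpace

end

theorem mainTheorem7 (m n : ℕ) (hm : 1 < m) (hn : 1 < n) (α β : ℂ → ℂ)
    (hα : ModelSpace.IsFiniteBlaschke m α) (hβ : ModelSpace.IsFiniteBlaschke n β)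
    (f : ModelSpace.K α) (g : ModelSpace.K β) (hf : f ≠ 0) (hg : g ≠ 0)
    (hgf : InnerProductSpace.rankOne ℂ g f ∈ ModelSpace.attOperators α β)
    (w : ℂ) (hw : ‖w‖ ≤ 1) :
    (ModelSpace.IsScalarMultiple (g : ModelSpace.L2) (ModelSpace.kernel β w) ↔
      ModelSpace.IsScalarMultiple (f : ModelSpace.L2) (ModelSpace.conjKernel α w)) ∧
    (ModelSpace.IsScalarMultiple (g : ModelSpace.L2) (ModelSpace.conjKernel β w) ↔
      ModelSpace.IsScalarMultiple (f : ModelSpace.L2) (ModelSpace.kernel α w)) := by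
  obtain ⟨c, a, h⟩ := hα.exists_isBlaschke
  obtain ⟨d, b, h'⟩ := hβ.exists_isBlaschke
  have hxy := fun k l (hk : k + 1 < m) (hl : l + 1 < n) =>
    ModelSpace.inner_mul_inner_succ_of_mem_attOperators h h' hgf hk hl
  have hx : ∃ k < m, inner ℂ (f : ModelSpace.L2) (h.mono k) ≠ 0 := by
    by_contra! h0
    exact hf (Subtype.ext (h.eq_zero_of_inner_mono f.2 h0))
  have hy : ∃ l < n, inner ℂ (h'.mono l) (g : ModelSpace.L2) ≠ 0 := by
    by_contra! h0
    exact hg (Subtype.ext (h'.eq_zero_of_inner_mono g.2 fun l hl => inner_eq_zero_symm.mp (h0 l hl)))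
  -- The sequence `y` consists of conjugated moments of `g`, so the ratio `w` for `g` becomes `conj
  -- w` for `y` in (a), and conversely in (b).
  have hconj : ∀ l, inner ℂ (h'.mono l) (g : ModelSpace.L2)
      = conj (inner ℂ (g : ModelSpace.L2) (h'.mono l)) := fun l => (inner_conj_symm _ _).symm
  rw [h'.isScalarMultiple_kernel_iff (by omega) hw g.2,
    h.isScalarMultiple_conjKernel_iff (by omega) hw f.2,
    h'.isScalarMultiple_conjKernel_iff (by omega) hw g.2,
    h.isScalarMultiple_kernel_iff (by omega) hw f.2,
    ← ModelSpace.geometric_iff_of_mul_succ hm hn hxy hx hy (conj w)]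
  -- For (b) the roles of the two sequences are exchanged.
  have hyx := ModelSpace.geometric_iff_of_mul_succ hn hm
    (fun l k hl hk => by simpa only [mul_comm] using hxy k l hk hl) hy hx w
  rw [hyx]
  simp only [hconj]
  constructor
  · refine forall₂_congr fun l _ => ?_
    rw [← map_mul, (starRingEnd ℂ).injective.eq_iff]
  · refine forall₂_congr fun l _ => ?_
    rw [← (starRingEnd ℂ).injective.eq_iff, map_mul, Complex.conj_conj]
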